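/- Let $R$ be a commutative ring with unit and let $S$ be an inverse semigroup, that is, a semigroup in which for every $s$ there is a unique $s^*$ with $ss^*s=s$ and $s^*ss^*=s^*$. Let $E(S)$ be its set of idempotents, ordered by $e\le f$ iff $ef=e$. For $e\in E(S)$ let $G_e=\{s\in S: s^*s=e=ss^*\}$ be the maximal subgroup at $e$, and let $RG_e$ and $RS$ denote the group algebra and the semigroup algebra. A (not necessarily unital) ring is called semiprime if every two-sided ideal $I$ with $I^2=0$ is zero. $E(S)$ is called pseudofinite if for each $e\in E(S)$ the set $\{f\in E(S): f<e\}$ is finitely generated as a lower set, that is, equals $\{f : f\le f_i\text{ for some }i\}$ for some finite (possibly empty) family $f_1,\dots,f_n\in E(S)$. Theorem. (1) If $RG_e$ is semiprime for every $e\in E(S)$, then $RS$ is semiprime. Conversely, if $E(S)$ is pseudofinite and $RS$ is semiprime, then $RG_e$ is semiprime for every $e\in E(S)$. (2) Suppose that $S$ has a zero element $z$, and let $R_0S=RS/Rz$ be the contracted semigroup algebra. If $RG_e$ is semiprime for every idempotent $e\neq z$, then $R_0S$ is semiprime. Conversely, if $S\neq\{z\}$, $E(S)$ is pseudofinite and $R_0S$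 is semiprime, then $RG_e$ is semiprime for every $e\in E(S)$. -/

import Mathlib

/-- An inverse semigroup: a semigroup in which every element `s` has a unique `t` with
`s * t * s = s` and `t * s * t = t`. -/
class IsInverseSemigroup (S : Type*) [Semigroup S] : Prop where
  existsUnique_inverse : ∀ s : S, ∃! t : S, s * t * s = s ∧ t * s * t = t

namespace InvSemigroup

section Basic

variable {S : Type*} [Semigroup S] [IsInverseSemigroup S]

/-- The element `s*`, the unique inverse of `s`. -/
noncomputable def sinv (s : S) : S :=
  (IsInverseSemigroup.existsUnique_inverse s).choose

theorem mul_sinv_mul (s : S) : s * sinv s * s = s :=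
  (IsInverseSemigroup.existsUnique_inverse s).choose_spec.1.1

theorem sinv_mul_sinv (s : S) : sinv s * s * sinv s = sinv s :=
  (IsInverseSemigroup.existsUnique_inverse s).choose_spec.1.2

theorem eq_sinv {s t : S} (h₁ : s * t * s = s) (h₂ : t * s * t = t) : t = sinv s :=
  (IsInverseSemigroup.existsUnique_inverse s).choose_spec.2 t ⟨h₁, h₂⟩

theorem sinv_sinv (s : S) : sinv (sinv s) = s :=
  (eq_sinv (sinv_mul_sinv s) (mul_sinv_mul s)).symm

theorem sinv_of_idem {e : S} (he : e * e = e) : sinv e = e :=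
  (eq_sinv (by rw [he, he]) (by rw [he, he])).symm

theorem idem_mul_idem {e f : S} (he : e * e = e) (hf : f * f = f) :
    e * f * (e * f) = e * f := by
  have h1 := mul_sinv_mul (e * f)
  have h2 := sinv_mul_sinv (e * f)
  set x := sinv (e * f) with hx
  have he' : ∀ a, e * (e * a) = e * a := fun a => by rw [← mul_assoc, he]
  have hf' : ∀ a, f * (f * a) = f * a := fun a => by rw [← mul_assoc, hf]
  have hx1 : f * x * e = x := by
    refine eq_sinv ?_ ?_
    · simpa only [mul_assoc, he', hf'] using h1
    · have := congrArg (fun a => f * a * e) h2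
      simpa only [mul_assoc, he', hf'] using this
  have hxx : x * x = x := by
    calc x * x = f * x * e * (f * x * e) := by rw [hx1]
      _ = f * (x * (e * f) * x) * e := by simp only [mul_assoc]
      _ = x := by rw [h2, hx1]
  have : e * f = x := by
    rw [← sinv_sinv (e * f), ← hx, sinv_of_idem hxx]
  rw [this, hxx]

/-- Idempotents of an inverse semigroup commute. -/
theorem idem_comm {e f : S} (he : e * e = e) (hf : f * f = f) : e * f = f * e := by
  have h1 := idem_mul_idem he hf
  have h2 := idem_mul_idem hf he
  have he' : ∀ a, e * (e * a) = e * a := fun a => by rw [← mul_assoc, he]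
  have hf' : ∀ a, f * (f * a) = f * a := fun a => by rw [← mul_assoc, hf]
  have h3 : f * e = sinv (e * f) := by
    refine eq_sinv ?_ ?_
    · simpa only [mul_assoc, he', hf'] using h1
    · simpa only [mul_assoc, he', hf'] using h2
  rw [h3, sinv_of_idem h1]

end Basic

section Idempotents

/-- The set `E(S)` of idempotents of `S`. -/
structure Idem (S : Type*) [Semigroup S] where
  /-- the underlying element of `S` -/
  val : S
  mul_self : val * val = val

variable {S : Type*} [Semigroup S]

@[ext] theorem Idem.ext' {e f : Idem S} (h : e.val = f.val) : e = f := by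
  cases e; cases f; cases h; rfl

variable [IsInverseSemigroup S]

/-- `E(S)` is a meet semilattice: `e ≤ f` means `e * f = e`, and the meet is the product. -/
instance : SemilatticeInf (Idem S) where
  le e f := e.val * f.val = e.val
  le_refl e := e.mul_self
  le_trans e f g (h₁ : _ = _) (h₂ : _ = _) :=
    show e.val * g.val = e.val by rw [← h₁, mul_assoc, h₂]
  le_antisymm e f (h₁ : _ = _) (h₂ : _ = _) := by
    ext; rw [← h₁, idem_comm e.mul_self f.mul_self, h₂]
  inf e f := ⟨e.val * f.val, idem_mul_idem e.mul_self f.mul_self⟩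
  inf_le_left e f := show e.val * f.val * e.val = e.val * f.val by
    rw [mul_assoc, ← idem_comm e.mul_self f.mul_self, ← mul_assoc, e.mul_self]
  inf_le_right e f := show e.val * f.val * f.val = e.val * f.val by
    rw [mul_assoc, f.mul_self]
  le_inf e f g (h₁ : _ = _) (h₂ : _ = _) := show e.val * (f.val * g.val) = e.val by
    rw [← mul_assoc, h₁, h₂]

end Idempotents

/-- A semilattice is pseudofinite if, for each `e`, the set of elements strictly below `e`
is finitely generated as a lower set. -/
def IsPseudofinite (E : Type*) [SemilatticeInf E] : Prop :=
  ∀ e : E, ∃ F : Finset E, Set.Iio e = (lowerClosure (F : Set E) : Set E)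

section MaximalSubgroup

variable {S : Type*} [Semigroup S] [IsInverseSemigroup S]

/-- The maximal subgroup `G_e = {s | s* s = e = s s*}` of `S` at the idempotent `e`. -/
structure MaxSubgroup (e : Idem S) where
  /-- the underlying element of `S` -/
  val : S
  sinv_mul : sinv val * val = e.val
  mul_sinv : val * sinv val = e.val

namespace MaxSubgroup

variable {e : Idem S}

@[ext] theorem ext' {s t : MaxSubgroup e} (h : s.val = t.val) : s = t := by
  cases s; cases t; cases h; rfl

theorem val_mul_idem (s : MaxSubgroup e) : s.val * e.val = s.val := by
  rw [← s.sinv_mul, ← mul_assoc, mul_sinv_mul]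

theorem idem_mul_val (s : MaxSubgroup e) : e.val * s.val = s.val := by
  rw [← s.mul_sinv, mul_sinv_mul]

theorem idem_mul_sinv (s : MaxSubgroup e) : e.val * sinv s.val = sinv s.val := by
  rw [← s.sinv_mul, sinv_mul_sinv]

theorem prod_left (s t : MaxSubgroup e) :
    sinv t.val * sinv s.val * (s.val * t.val) = e.val := by
  rw [mul_assoc, ← mul_assoc (sinv s.val), s.sinv_mul, idem_mul_val, t.sinv_mul]

theorem prod_right (s t : MaxSubgroup e) :
    s.val * t.val * (sinv t.val * sinv s.val) = e.val := by
  rw [mul_assoc, ← mul_assoc t.val, t.mul_sinv, idem_mul_sinv, s.mul_sinv]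

theorem sinv_mul_val (s t : MaxSubgroup e) :
    sinv (s.val * t.val) = sinv t.val * sinv s.val := by
  refine (eq_sinv ?_ ?_).symm
  · rw [prod_right, ← mul_assoc, idem_mul_val]
  · rw [prod_left, ← mul_assoc, idem_mul_sinv]

/-- The group structure of `G_e`: the product is that of `S`, the identity is `e` and the
inverse of `s` is `s*`. -/
noncomputable instance : Group (MaxSubgroup e) where
  mul s t := ⟨s.val * t.val, by rw [sinv_mul_val, prod_left], by rw [sinv_mul_val, prod_right]⟩
  one := ⟨e.val, by rw [sinv_of_idem e.mul_self, e.mul_self],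
    by rw [sinv_of_idem e.mul_self, e.mul_self]⟩
  inv s := ⟨sinv s.val, by rw [sinv_sinv, s.mul_sinv], by rw [sinv_sinv, s.sinv_mul]⟩
  mul_assoc s t u := ext' (mul_assoc s.val t.val u.val)
  one_mul s := ext' s.idem_mul_val
  mul_one s := ext' s.val_mul_idem
  inv_mul_cancel s := ext' s.sinv_mul

end MaxSubgroup

end MaximalSubgroup

/-- A (not necessarily unital) ring is semiprime if every two-sided ideal `I` with `I² = 0`
is zero. -/
def IsSemiprimeRing (A : Type*) [NonUnitalRing A] : Prop :=
  ∀ I : TwoSidedIdeal A, (∀ a ∈ I, ∀ b ∈ I, a * b = 0) → I = ⊥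

section Contracted

variable (R : Type*) [CommRing R] {S : Type*} [Semigroup S]

/-- `z` is a zero element of `S`. -/
def IsZeroElem (z : S) : Prop := ∀ s : S, z * s = z ∧ s * z = z

theorem mul_single_zero {z : S} (hz : IsZeroElem z) (x : MonoidAlgebra R S) (r : R) :
    ∃ c : R, x * MonoidAlgebra.single z r = MonoidAlgebra.single z c := by
  induction x using MonoidAlgebra.induction_linear with
  | zero => exact ⟨0, by simp⟩
  | add f g hf hg =>
    obtain ⟨a, ha⟩ := hf
    obtain ⟨b, hb⟩ := hg
    exact ⟨a + b, by rw [add_mul, ha, hb, MonoidAlgebra.single_add]⟩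
  | single s a => exact ⟨a * r, by rw [MonoidAlgebra.single_mul_single, (hz s).2]⟩

theorem single_zero_mul {z : S} (hz : IsZeroElem z) (x : MonoidAlgebra R S) (r : R) :
    ∃ c : R, MonoidAlgebra.single z r * x = MonoidAlgebra.single z c := by
  induction x using MonoidAlgebra.induction_linear with
  | zero => exact ⟨0, by simp⟩
  | add f g hf hg =>
    obtain ⟨a, ha⟩ := hf
    obtain ⟨b, hb⟩ := hg
    exact ⟨a + b, by rw [mul_add, ha, hb, MonoidAlgebra.single_add]⟩
  | single s a => exact ⟨r * a, by rw [MonoidAlgebra.single_mul_single, (hz s).1]⟩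

/-- The two-sided ideal `Rz` of the semigroup algebra `RS`, for a zero element `z` of `S`. -/
noncomputable def zeroIdeal {z : S} (hz : IsZeroElem z) : TwoSidedIdeal (MonoidAlgebra R S) :=
  TwoSidedIdeal.mk' {x | ∃ r : R, x = MonoidAlgebra.single z r}
    ⟨0, by simp⟩
    (by
      rintro _ _ ⟨a, rfl⟩ ⟨b, rfl⟩
      exact ⟨a + b, by rw [MonoidAlgebra.single_add]⟩)
    (by
      rintro _ ⟨a, rfl⟩
      exact ⟨-a, by rw [MonoidAlgebra.single_neg]⟩)
    (by
      rintro x _ ⟨a, rfl⟩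
      exact mul_single_zero R hz x a)
    (by
      rintro _ y ⟨a, rfl⟩
      exact single_zero_mul R hz y a)

/-- The contracted semigroup algebra `R₀S = RS / Rz`. -/
abbrev ContractedAlgebra {z : S} (hz : IsZeroElem z) : Type _ :=
  (zeroIdeal R hz).ringCon.Quotient

end Contracted

end InvSemigroup

/-!
Fix an idempotent `e` and let `φ : RS → RG_e` be the linear map `groupPart`, with `φ t = t e` if
`t e ∈ G_e` and `φ t = 0` otherwise. It is `RG_e`-linear on both sides, so it maps ideals to ideals.
It is not multiplicative: `y e` may have components in the `L`-class of `e` outside `G_e`. There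
are finitely many of them, and their range idempotents differ from `e`; multiplying `y` on the left
by `e`, and by `e - f` for each of these ranges `f < e`, removes them. Hence for each `y` there is a
`p` with `φ (x p y) = φ x * φ y` for all `x` (`exists_groupPart_mul_mul`), and `φ` takes a
square-zero ideal to a square-zero ideal. If all `RG_e` are semiprime, a square-zero ideal of `RS`
is therefore killed by all the maps `φ`, and these are jointly faithful on ideals: for `s` maximal
in the support of `x`, the coefficient of `x` at `s` is the coefficient of the identity in the
`G_e`-part of `s* x`, where `e = s* s` (`coeff_eq_zero_of_groupPart`).

Conversely, if the set of idempotents strictly below `e` is finitely generated, the product `p` of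
the `e - f` over generators `f` annihilates every idempotent `< e`. Then `p RS p = RG_e p`, so a
square-zero ideal `J` of `RG_e` yields elements `j p` with `(j p) RS (j p) = 0`. If `RS` is
semiprime then `j p = 0`, and `j = φ (j p) = 0` (`isSemiprimeRing_maxSubgroup`).

Both arguments are carried out modulo the span of an ideal `Z` of `S`. The case `Z = ∅` gives `RS`
and `Z = {z}` gives `R₀S`. For the converse in the latter case, the idempotent `z` is treated
separately: `G_z` is trivial, and `R` is reduced because a scalar `r` with `r² = 0` satisfies
`(r s) R₀S (r s) = 0` for any `s ≠ z`.
-/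

namespace InvSemigroup

open MonoidAlgebra (single)

/-! ### Semiprime rings -/

section Semiprime

variable {A B : Type*} [NonUnitalRing A] [NonUnitalRing B]

/-- Elementwise consequence of semiprimeness. Without a unit, `b * B * b = 0` alone does not
make the ideal generated by `b` square to zero, so `b * b = 0` is asked for as well. -/
theorem IsSemiprimeRing.eq_zero (hB : IsSemiprimeRing B) {b : B} (hb : b * b = 0)
    (h : ∀ x, b * x * b = 0) : b = 0 := by
  -- the ideal generated by `b` lies in `{y | b * y = 0 ∧ b * B * y = 0}`
  have h1 : ∀ y ∈ TwoSidedIdeal.span {b}, b * y = 0 ∧ ∀ x, b * x * y = 0 := by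
    intro y hy
    induction hy using TwoSidedIdeal.span_induction with
    | mem y hy =>
      obtain rfl : y = b := hy
      exact ⟨hb, h⟩
    | zero => simp
    | add y z _ _ hy hz => exact ⟨by rw [mul_add, hy.1, hz.1, add_zero],
        fun x => by rw [mul_add, hy.2, hz.2, add_zero]⟩
    | neg y _ hy => exact ⟨by rw [mul_neg, hy.1, neg_zero],
        fun x => by rw [mul_neg, hy.2, neg_zero]⟩
    | left_absorb a y _ hy => exact ⟨by rw [← mul_assoc, hy.2],
        fun x => by rw [← mul_assoc, mul_assoc b x a, hy.2]⟩
    | right_absorb a y _ hy => exact ⟨by rw [← mul_assoc, hy.1, zero_mul],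
        fun x => by rw [← mul_assoc, hy.2, zero_mul]⟩
  have h2 : ∀ x ∈ TwoSidedIdeal.span {b}, ∀ y ∈ TwoSidedIdeal.span {b}, x * y = 0 := by
    intro x hx
    induction hx using TwoSidedIdeal.span_induction with
    | mem x hx =>
      obtain rfl : x = b := hx
      exact fun y hy => (h1 y hy).1
    | zero => simp
    | add x z _ _ hx hz => exact fun y hy => by rw [add_mul, hx y hy, hz y hy, add_zero]
    | neg x _ hx => exact fun y hy => by rw [neg_mul, hx y hy, neg_zero]
    | left_absorb a x _ hx => exact fun y hy => by rw [mul_assoc, hx y hy, mul_zero]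
    | right_absorb a x _ hx =>
      intro y hy
      rw [mul_assoc, hx _ (TwoSidedIdeal.mul_mem_left _ a y hy)]
  have h3 : b ∈ TwoSidedIdeal.span {b} := TwoSidedIdeal.subset_span rfl
  rw [hB _ h2] at h3
  simpa [TwoSidedIdeal.mem_bot] using h3

theorem isSemiprimeRing_of_forall_eq_zero
    (h : ∀ I : TwoSidedIdeal A, (∀ a ∈ I, ∀ b ∈ I, a * b = 0) → ∀ a ∈ I, a = 0) :
    IsSemiprimeRing A := fun I hI => by
  ext a
  rw [TwoSidedIdeal.mem_bot]
  exact ⟨h I hI a, fun ha => ha ▸ I.zero_mem⟩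

end Semiprime

/-! ### Inverse semigroups -/

section Semigroup

variable {S : Type*} [Semigroup S] [IsInverseSemigroup S]

theorem mul_sinv_idem (s : S) : s * sinv s * (s * sinv s) = s * sinv s := by
  rw [← mul_assoc, mul_sinv_mul]

theorem sinv_mul_idem (s : S) : sinv s * s * (sinv s * s) = sinv s * s := by
  rw [← mul_assoc, sinv_mul_sinv]

theorem sinv_mul_rev (s t : S) : sinv (s * t) = sinv t * sinv s := by
  have hc := idem_comm (mul_sinv_idem t) (sinv_mul_idem s)
  refine (eq_sinv ?_ ?_).symm
  · calc s * t * (sinv t * sinv s) * (s * t)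
        = s * (t * sinv t * (sinv s * s)) * t := by simp only [mul_assoc]
      _ = s * sinv s * s * (t * sinv t * t) := by rw [hc]; simp only [mul_assoc]
      _ = s * t := by rw [mul_sinv_mul, mul_sinv_mul]
  · calc sinv t * sinv s * (s * t) * (sinv t * sinv s)
        = sinv t * (sinv s * s * (t * sinv t)) * sinv s := by simp only [mul_assoc]
      _ = sinv t * t * sinv t * (sinv s * s * sinv s) := by rw [← hc]; simp only [mul_assoc]
      _ = sinv t * sinv s := by rw [sinv_mul_sinv, sinv_mul_sinv]

/-- The idempotent `s* s`. -/
noncomputable def domIdem (s : S) : Idem S := ⟨sinv s * s, sinv_mul_idem s⟩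

/-- The idempotent `s s*`. -/
noncomputable def ranIdem (s : S) : Idem S := ⟨s * sinv s, mul_sinv_idem s⟩

theorem mul_domIdem (s : S) : s * (domIdem s).val = s := by
  rw [domIdem, ← mul_assoc, mul_sinv_mul]

theorem ranIdem_mul (s : S) : (ranIdem s).val * s = s := mul_sinv_mul s

theorem Idem.le_iff {e f : Idem S} : e ≤ f ↔ e.val * f.val = e.val := Iff.rfl

theorem Idem.mul_eq_of_le {e f : Idem S} (h : e ≤ f) : e.val * f.val = e.val := h

theorem Idem.mul_eq_of_le' {e f : Idem S} (h : e ≤ f) : f.val * e.val = e.val := by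
  rw [idem_comm f.mul_self e.mul_self]; exact h

theorem domIdem_le {s : S} {e : Idem S} (h : s * e.val = s) : domIdem s ≤ e := by
  rw [Idem.le_iff, domIdem, mul_assoc, h]

theorem ranIdem_le {s : S} {e : Idem S} (h : e.val * s = s) : ranIdem s ≤ e := by
  rw [Idem.le_iff, idem_comm (ranIdem s).mul_self e.mul_self, ranIdem, ← mul_assoc, h]

/-- `g e g*` is an idempotent strictly below `f` whenever `e < f` and `g ∈ G_f`. -/
theorem MaxSubgroup.conj_lt {f : Idem S} (g : MaxSubgroup f) {e : Idem S} (he : e < f) :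
    ranIdem (g.val * e.val) < f := by
  refine lt_of_le_of_ne (ranIdem_le (by rw [← mul_assoc, g.idem_mul_val])) fun h => he.not_ge ?_
  have h1 : g.val * e.val * sinv (g.val * e.val) = f.val := congrArg Idem.val h
  rw [sinv_mul_rev, sinv_of_idem e.mul_self, mul_assoc, ← mul_assoc e.val, e.mul_self] at h1
  rw [Idem.le_iff]
  have h2 : f.val * e.val = sinv g.val * (g.val * (e.val * sinv g.val)) * g.val := by
    rw [← mul_assoc (sinv g.val), g.sinv_mul, mul_assoc, mul_assoc, g.sinv_mul,
      Idem.mul_eq_of_le he.le]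
  rw [h2, h1, mul_assoc, g.idem_mul_val, g.sinv_mul]

/-- The natural partial order of an inverse semigroup: `s ≤ t` if `s` is the restriction of `t`
to the domain idempotent `s* s`. -/
abbrev naturalPartialOrder (S : Type*) [Semigroup S] [IsInverseSemigroup S] : PartialOrder S where
  le s t := t * (sinv s * s) = s
  le_refl s := mul_domIdem s
  le_trans s t u (h₁ : _ = _) (h₂ : _ = _) := by
    have hst : s * (sinv t * t) = s := by
      calc s * (sinv t * t) = t * (sinv s * s) * (sinv t * t) := by rw [h₁]
        _ = t * (sinv t * t) * (sinv s * s) := by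
          rw [mul_assoc, idem_comm (sinv_mul_idem s) (sinv_mul_idem t), ← mul_assoc]
        _ = s := by rw [← mul_assoc t, mul_sinv_mul, h₁]
    have h : sinv t * t * (sinv s * s) = sinv s * s :=
      Idem.mul_eq_of_le' (domIdem_le (e := domIdem t) hst)
    show u * (sinv s * s) = s
    rw [← h, ← mul_assoc, h₂, h₁]
  le_antisymm s t (h₁ : _ = _) (h₂ : _ = _) := by
    calc s = t * (sinv s * s) := h₁.symm
      _ = s * (sinv t * t) * (sinv s * s) := by rw [h₂]
      _ = s * (sinv s * s) * (sinv t * t) := by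
        rw [mul_assoc, idem_comm (sinv_mul_idem t) (sinv_mul_idem s), ← mul_assoc]
      _ = t := by rw [← mul_assoc s, mul_sinv_mul, h₂]

namespace MaxSubgroup

variable {e : Idem S}

@[simp] theorem val_mul (g h : MaxSubgroup e) : (g * h).val = g.val * h.val := rfl

@[simp] theorem val_one : (1 : MaxSubgroup e).val = e.val := rfl

@[simp] theorem val_inv (g : MaxSubgroup e) : g⁻¹.val = sinv g.val := rfl

/-- Right multiplication by `G_e` does not change whether `t * e` lies in `G_e`. -/
theorem mul_val_mul_idem_eq_iff {t : S} {g h : MaxSubgroup e} :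
    t * h.val * e.val = g.val ↔ t * e.val = (g * h⁻¹).val := by
  rw [mul_assoc, val_mul_idem, val_mul, val_inv]
  constructor
  · intro H
    rw [← H, mul_assoc, h.mul_sinv]
  · intro H
    rw [← h.idem_mul_val, ← mul_assoc, H, mul_assoc, h.sinv_mul, g.val_mul_idem]

/-- Left multiplication by `G_e` does not change whether `t * e` lies in `G_e`. -/
theorem val_mul_mul_idem_eq_iff {t : S} {g h : MaxSubgroup e} :
    h.val * t * e.val = g.val ↔ t * e.val = (h⁻¹ * g).val := by
  constructor
  · intro H
    set v := t * e.val with hv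
    set k := h⁻¹ * g
    have hve : v * e.val = v := by rw [hv, mul_assoc, e.mul_self]
    have hk : e.val * v = k.val := by
      rw [val_mul, val_inv, ← H, mul_assoc h.val, ← mul_assoc (sinv h.val), h.sinv_mul]
    calc v = v * (sinv k.val * k.val) := by rw [k.sinv_mul, hve]
      _ = v * (sinv v * e.val * (e.val * v)) := by
        rw [← hk, sinv_mul_rev, sinv_of_idem e.mul_self]
      _ = v * sinv v * (e.val * e.val) * v := by simp only [mul_assoc]
      _ = e.val * v := by
        rw [e.mul_self, idem_comm (mul_sinv_idem v) e.mul_self, mul_assoc, mul_sinv_mul]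
      _ = k.val := hk
  · intro H
    rw [mul_assoc, H, val_mul, val_inv, ← mul_assoc, h.mul_sinv, g.idem_mul_val]

end MaxSubgroup

/-- If some `x ∈ S e` carries `v ∈ S e` into `G_e`, then `v` has domain idempotent `e` and its
range idempotent lies below `e`. -/
theorem sinv_mul_eq_and_ranIdem_le {e : Idem S} {x v : S} {k : MaxSubgroup e}
    (hx : x * e.val = x) (hv : v * e.val = v) (h : x * v = k.val) :
    sinv v * v = e.val ∧ ranIdem v ≤ e := by
  obtain ⟨y, hy, hyv⟩ : ∃ y, y * e.val = y ∧ y * v = e.val :=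
    ⟨sinv k.val * x, by rw [mul_assoc, hx], by rw [mul_assoc, h, k.sinv_mul]⟩
  have hev : e.val * sinv v = sinv v := by
    conv_rhs => rw [← hv, sinv_mul_rev, sinv_of_idem e.mul_self]
  refine ⟨?_, ?_⟩
  · calc sinv v * v = sinv v * v * e.val := by rw [mul_assoc, hv]
      _ = e.val * (sinv v * v) := idem_comm (sinv_mul_idem v) e.mul_self
      _ = e.val := by rw [← hyv, mul_assoc, ← mul_assoc v, mul_sinv_mul]
  · have hyr : y * (v * sinv v) = sinv v := by rw [← mul_assoc, hyv, hev]
    have : sinv v * e.val = sinv v := by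
      rw [← hyr, mul_assoc, idem_comm (mul_sinv_idem v) e.mul_self, ← mul_assoc, hy]
    rw [Idem.le_iff, ranIdem, mul_assoc, this]

/-- If `s* t s* s = s* s` then `s ≤ t`. -/
theorem mul_sinv_mul_eq_of_sinv_mul_mul {s t : S}
    (h : sinv s * t * (sinv s * s) = sinv s * s) : t * (sinv s * s) = s := by
  set v := t * (sinv s * s) with hv
  have h1 : sinv s * v = sinv s * s := by rw [hv, ← mul_assoc, h]
  -- `s*` is an inverse of `v`, so that `v = s** = s`
  rw [← sinv_sinv s]
  refine eq_sinv ?_ ?_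
  · rw [h1, sinv_mul_sinv]
  · rw [mul_assoc, h1, hv, mul_assoc, sinv_mul_idem]

end Semigroup

section SemigroupAlgebra

variable {R : Type*} [CommRing R] {S : Type*} [Semigroup S] [IsInverseSemigroup S]

/-! ### The semigroup algebra and the group algebras of the maximal subgroups -/

section GroupPart

variable {e : Idem S}

/-- The inclusion `RG_e → RS`. -/
noncomputable def groupIncl (R : Type*) [CommRing R] (e : Idem S) :
    MonoidAlgebra R (MaxSubgroup e) →ₙₐ[R] MonoidAlgebra R S :=
  MonoidAlgebra.mapDomainNonUnitalAlgHom R R ⟨MaxSubgroup.val, MaxSubgroup.val_mul⟩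

@[simp] theorem groupIncl_single (g : MaxSubgroup e) (r : R) :
    groupIncl R e (single g r) = single g.val r := by
  simp [groupIncl]

open Classical in
/-- The `R`-linear map `RS → RG_e` sending `t` to `t e` if `t e ∈ G_e` and to `0` otherwise.
It is the action of `RS` on the Schützenberger module `R L_e` (with basis the `L`-class of `e`),
applied to `e` and projected onto `RG_e`. It is not multiplicative in general. -/
noncomputable def groupPart (R : Type*) [CommRing R] (e : Idem S) :
    MonoidAlgebra R S →ₗ[R] MonoidAlgebra R (MaxSubgroup e) :=
  Finsupp.linearCombination R (fun t : S =>
    if h : ∃ g : MaxSubgroup e, t * e.val = g.val then single h.choose 1 else 0) ∘ₗ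
    (MonoidAlgebra.coeffLinearEquiv R).toLinearMap

theorem groupPart_single_of_eq {t : S} {g : MaxSubgroup e} (h : t * e.val = g.val) (r : R) :
    groupPart R e (single t r) = single g r := by
  have h' : ∃ g : MaxSubgroup e, t * e.val = g.val := ⟨g, h⟩
  have : h'.choose = g := MaxSubgroup.ext' (h'.choose_spec.symm.trans h)
  simp [groupPart, h', this]

theorem groupPart_single_of_forall_ne {t : S} (h : ∀ g : MaxSubgroup e, t * e.val ≠ g.val)
    (r : R) : groupPart R e (single t r) = 0 := by
  simp [groupPart, h]

theorem groupPart_eq_sum (x : MonoidAlgebra R S) :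
    groupPart R e x = ∑ t ∈ x.coeff.support, groupPart R e (single t (x.coeff t)) := by
  conv_lhs => rw [← MonoidAlgebra.sum_coeff_single x, Finsupp.sum, map_sum]

theorem groupPart_mul_groupIncl (x : MonoidAlgebra R S) (b : MonoidAlgebra R (MaxSubgroup e)) :
    groupPart R e (x * groupIncl R e b) = groupPart R e x * b := by
  induction b using MonoidAlgebra.induction_linear with
  | zero => simp
  | add b c hb hc => rw [map_add, mul_add, map_add, hb, hc, mul_add]
  | single h r =>
    induction x using MonoidAlgebra.induction_linear with
    | zero => simp
    | add x y hx hy => rw [add_mul, map_add, hx, hy, map_add, add_mul]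
    | single t a =>
      rw [groupIncl_single, MonoidAlgebra.single_mul_single]
      by_cases H : ∃ g : MaxSubgroup e, t * e.val = g.val
      · obtain ⟨g, hg⟩ := H
        rw [groupPart_single_of_eq hg, MonoidAlgebra.single_mul_single,
          groupPart_single_of_eq (g := g * h)]
        rw [MaxSubgroup.mul_val_mul_idem_eq_iff, hg, mul_inv_cancel_right]
      · push Not at H
        rw [groupPart_single_of_forall_ne H, zero_mul, groupPart_single_of_forall_ne]
        intro g hg
        exact H _ (MaxSubgroup.mul_val_mul_idem_eq_iff.1 hg)

theorem groupPart_groupIncl_mul (b : MonoidAlgebra R (MaxSubgroup e)) (x : MonoidAlgebra R S) :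
    groupPart R e (groupIncl R e b * x) = b * groupPart R e x := by
  induction b using MonoidAlgebra.induction_linear with
  | zero => simp
  | add b c hb hc => rw [map_add, add_mul, map_add, hb, hc, add_mul]
  | single h r =>
    induction x using MonoidAlgebra.induction_linear with
    | zero => simp
    | add x y hx hy => rw [mul_add, map_add, hx, hy, map_add, mul_add]
    | single t a =>
      rw [groupIncl_single, MonoidAlgebra.single_mul_single]
      by_cases H : ∃ g : MaxSubgroup e, t * e.val = g.val
      · obtain ⟨g, hg⟩ := H
        rw [groupPart_single_of_eq hg, MonoidAlgebra.single_mul_single,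
          groupPart_single_of_eq (g := h * g)]
        rw [MaxSubgroup.val_mul_mul_idem_eq_iff, hg, inv_mul_cancel_left]
      · push Not at H
        rw [groupPart_single_of_forall_ne H, mul_zero, groupPart_single_of_forall_ne]
        intro g hg
        exact H _ (MaxSubgroup.val_mul_mul_idem_eq_iff.1 hg)

theorem groupPart_mul_single_idem (x : MonoidAlgebra R S) :
    groupPart R e (x * single e.val 1) = groupPart R e x := by
  have := groupPart_mul_groupIncl (e := e) x 1
  rwa [mul_one, MonoidAlgebra.one_def, groupIncl_single] at this

theorem groupPart_groupIncl (b : MonoidAlgebra R (MaxSubgroup e)) :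
    groupPart R e (groupIncl R e b) = b := by
  induction b using MonoidAlgebra.induction_linear with
  | zero => simp
  | add b c hb hc => rw [map_add, map_add, hb, hc]
  | single h r => rw [groupIncl_single, groupPart_single_of_eq h.val_mul_idem]

/-- An element supported on an ideal `Z` of `S` that does not contain `e` has zero
`G_e`-part. -/
theorem groupPart_eq_zero_of_supported {Z : Set S} (hZl : ∀ s, ∀ t ∈ Z, s * t ∈ Z)
    (hZr : ∀ s ∈ Z, ∀ t, s * t ∈ Z) (he : e.val ∉ Z) {x : MonoidAlgebra R S}
    (hx : ∀ s, s ∉ Z → x.coeff s = 0) : groupPart R e x = 0 := by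
  rw [groupPart_eq_sum]
  refine Finset.sum_eq_zero fun t ht => groupPart_single_of_forall_ne (fun g hg => he ?_) _
  have htZ : t ∈ Z := by
    by_contra h
    exact Finsupp.mem_support_iff.1 ht (hx t h)
  rw [← g.sinv_mul, ← hg]
  exact hZl _ _ (hZr _ htZ _)

end GroupPart

/-! ### Elements of the semilattice algebra separating idempotents -/

section Below

variable {e : Idem S}

/-- The span in `RS` of the idempotents strictly below `e`. -/
noncomputable def below (R : Type*) [CommRing R] (e : Idem S) : Submodule R (MonoidAlgebra R S) :=
  Submodule.span R {x | ∃ f : Idem S, f < e ∧ x = single f.val 1}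

theorem eq_zero_of_mem_below {M : Type*} [AddCommGroup M] [Module R M]
    {l : MonoidAlgebra R S →ₗ[R] M} (h : ∀ f : Idem S, f < e → l (single f.val 1) = 0)
    {q : MonoidAlgebra R S} (hq : q ∈ below R e) : l q = 0 := by
  have : below R e ≤ LinearMap.ker l := Submodule.span_le.2 (by
    rintro _ ⟨f, hf, rfl⟩
    exact h f hf)
  exact this hq

theorem mul_single_mem_below {q : MonoidAlgebra R S} (hq : q ∈ below R e) (f : Idem S) :
    q * single f.val 1 ∈ below R e := by
  have : below R e ≤ (below R e).comap (LinearMap.mulRight R (single f.val (1 : R))) :=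
    Submodule.span_le.2 (by
      rintro _ ⟨g, hg, rfl⟩
      refine Submodule.subset_span ⟨g ⊓ f, inf_le_left.trans_lt hg, ?_⟩
      rw [LinearMap.mulRight_apply, MonoidAlgebra.single_mul_single, mul_one]
      rfl)
  exact this hq

/-- For finitely many idempotents `f < e`, the product of the `e - f` has the form `e + q` with `q`
in the span of the idempotents strictly below `e`, and annihilates each `f`. -/
theorem exists_below_mul_eq_zero (F : Finset (Idem S)) (hF : ∀ f ∈ F, f < e) :
    ∃ q ∈ below R e, ∀ f ∈ F, (single e.val 1 + q) * single f.val (1 : R) = 0 := by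
  classical
  induction F using Finset.induction_on with
  | empty => exact ⟨0, Submodule.zero_mem _, by simp⟩
  | insert f F _ ih =>
    obtain ⟨q, hq, h⟩ := ih fun g hg => hF g (Finset.mem_insert_of_mem hg)
    have hfe : f < e := hF f (Finset.mem_insert_self f F)
    have hef : (single e.val 1 * single f.val 1 : MonoidAlgebra R S) = single f.val 1 := by
      rw [MonoidAlgebra.single_mul_single, mul_one, Idem.mul_eq_of_le' hfe.le]
    refine ⟨q - (single f.val 1 + q * single f.val 1), Submodule.sub_mem _ hq
      (Submodule.add_mem _ (Submodule.subset_span ⟨f, hfe, rfl⟩) (mul_single_mem_below hq f)),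
      fun g hg => ?_⟩
    have hp : (single e.val 1 + (q - (single f.val 1 + q * single f.val 1)) : MonoidAlgebra R S)
        = (single e.val 1 + q) - (single e.val 1 + q) * single f.val 1 := by
      rw [add_mul, hef]; abel
    rw [hp, sub_mul, mul_assoc, MonoidAlgebra.single_mul_single, mul_one]
    rcases Finset.mem_insert.1 hg with rfl | hg
    · rw [g.mul_self, sub_self]
    · rw [idem_comm f.mul_self g.mul_self, ← mul_one (1 : R), ← MonoidAlgebra.single_mul_single,
        ← mul_assoc, mul_one, h g hg, zero_mul, sub_zero]

theorem groupPart_mul_below (x : MonoidAlgebra R S) {q : MonoidAlgebra R S}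
    (hq : q ∈ below R e) : groupPart R e (x * q) = 0 := by
  refine eq_zero_of_mem_below (l := groupPart R e ∘ₗ LinearMap.mulLeft R x) (fun f hf => ?_) hq
  rw [LinearMap.comp_apply, LinearMap.mulLeft_apply]
  induction x using MonoidAlgebra.induction_linear with
  | zero => simp
  | add x y hx hy => rw [add_mul, map_add, hx, hy, add_zero]
  | single t r =>
    rw [MonoidAlgebra.single_mul_single]
    refine groupPart_single_of_forall_ne (fun g hg => hf.ne ?_) _
    -- `t * f = g` is fixed by right multiplication by `f`, hence so is `g* g = e`
    rw [mul_assoc, Idem.mul_eq_of_le hf.le] at hg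
    have h1 : g.val * f.val = g.val := by rw [← hg, mul_assoc, f.mul_self]
    ext
    rw [← Idem.mul_eq_of_le' hf.le, ← g.sinv_mul, mul_assoc, h1]

/-- The element `p = e + q` separates `e` from the ranges of the elements of `L_e` occurring in
`y e`, so that `p y e` is the component of `y e` in `RG_e`. This makes `groupPart` multiplicative
after inserting `p`. -/
theorem exists_groupPart_mul_mul (y : MonoidAlgebra R S) :
    ∃ p : MonoidAlgebra R S, ∀ x : MonoidAlgebra R S,
      groupPart R e (x * (p * y)) = groupPart R e x * groupPart R e y := by
  classical
  obtain ⟨q, hq, h⟩ := exists_below_mul_eq_zero (R := R) (e := e)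
    ((y.coeff.support.image fun s => ranIdem (s * e.val)).filter (· < e))
    (fun f hf => (Finset.mem_filter.1 hf).2)
  refine ⟨single e.val 1 + q, fun x => ?_⟩
  have key : ∀ s ∈ y.coeff.support, ∀ r : R,
      groupPart R e (x * ((single e.val 1 + q) * single s r)) =
        groupPart R e x * groupPart R e (single s r) := by
    intro s hs r
    set v := s * e.val with hv
    have hve : v * e.val = v := by rw [hv, mul_assoc, e.mul_self]
    have hsv : (single s r * single e.val 1 : MonoidAlgebra R S) = single v r := by
      rw [MonoidAlgebra.single_mul_single, mul_one]
    rw [← groupPart_mul_single_idem, mul_assoc, mul_assoc, hsv]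
    by_cases H : ∃ g : MaxSubgroup e, v = g.val
    · obtain ⟨g, hg⟩ := H
      rw [groupPart_single_of_eq hg, ← mul_assoc, hg, ← groupIncl_single,
        groupPart_mul_groupIncl, mul_add, map_add, groupPart_mul_below _ hq, add_zero,
        groupPart_mul_single_idem]
    · have H' : ∀ g : MaxSubgroup e, s * e.val ≠ g.val := fun g hg => H ⟨g, hg⟩
      rw [groupPart_single_of_forall_ne H', mul_zero]
      by_cases hr : ranIdem v < e
      · rw [← ranIdem_mul v, ← one_mul r, ← MonoidAlgebra.single_mul_single,
          ← mul_assoc (_ + _), h _ (by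
            simp only [Finset.mem_filter, Finset.mem_image]
            exact ⟨⟨s, hs, rfl⟩, hr⟩), zero_mul, mul_zero, map_zero]
      · have hz : ∀ f : Idem S, f ≤ e →
            groupPart R e (x * (single f.val 1 * single v r)) = 0 := by
          intro f hf
          rw [← mul_assoc]
          induction x using MonoidAlgebra.induction_linear with
          | zero => simp
          | add x y hx hy => rw [add_mul, add_mul, map_add, hx, hy, add_zero]
          | single t a =>
            rw [MonoidAlgebra.single_mul_single, MonoidAlgebra.single_mul_single]
            refine groupPart_single_of_forall_ne (fun g hg => ?_) _
            rw [mul_assoc, hve] at hg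
            obtain ⟨h1, h2⟩ := sinv_mul_eq_and_ranIdem_le
              (by rw [mul_assoc, Idem.mul_eq_of_le hf]) hve hg
            have h3 : ranIdem v = e := h2.eq_of_not_lt hr
            exact H ⟨⟨v, h1, congrArg Idem.val h3⟩, rfl⟩
        rw [add_mul, mul_add, map_add, hz e le_rfl, zero_add]
        exact eq_zero_of_mem_below
          (l := groupPart R e ∘ₗ LinearMap.mulLeft R x ∘ₗ LinearMap.mulRight R (single v r))
          (fun f hf => hz f hf.le) hq
  have hy : y = ∑ s ∈ y.coeff.support, single s (y.coeff s) :=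
    (MonoidAlgebra.sum_coeff_single y).symm
  rw [groupPart_eq_sum y]
  conv_lhs => rw [hy]
  rw [Finset.mul_sum, Finset.mul_sum, map_sum, Finset.mul_sum]
  exact Finset.sum_congr rfl fun s hs => key s hs _

end Below

/-! ### Semiprimeness passes from the group algebras to quotients by ideals of `S` -/

section Direct

/-- The maps `x ↦ groupPart R (s* s) (s* x)` jointly detect the coefficients of `x` outside a
right ideal `Z` of `S`: if `s` is maximal in the support of `x` outside `Z`, then the coefficient
of `x` at `s` is that of the identity in the image of `x`. -/
theorem coeff_eq_zero_of_groupPart {Z : Set S}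
    (hZr : ∀ s ∈ Z, ∀ t, s * t ∈ Z) {x : MonoidAlgebra R S}
    (h : ∀ s, s ∉ Z → groupPart R (domIdem s) (single (sinv s) 1 * x) = 0) :
    ∀ s, s ∉ Z → x.coeff s = 0 := by
  classical
  let _ := naturalPartialOrder S
  by_contra! hx
  obtain ⟨s₀, hs₀, hx₀⟩ := hx
  -- choose `s` maximal for the natural order in the support of `x` outside `Z`
  obtain ⟨s, hs⟩ := (x.coeff.support.filter (· ∉ Z)).exists_maximal
    ⟨s₀, Finset.mem_filter.2 ⟨Finsupp.mem_support_iff.2 hx₀, hs₀⟩⟩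
  obtain ⟨hsx, hsZ⟩ := Finset.mem_filter.1 hs.1
  refine Finsupp.mem_support_iff.1 hsx ?_
  have hsum : single (sinv s) 1 * x
      = ∑ t ∈ x.coeff.support, single (sinv s * t) (x.coeff t) := by
    conv_lhs => rw [← MonoidAlgebra.sum_coeff_single x, Finsupp.sum, Finset.mul_sum]
    simp only [MonoidAlgebra.single_mul_single, one_mul]
  have hcoef := congrArg (fun b => b.coeff 1) (h s hsZ)
  simp only [hsum, map_sum, MonoidAlgebra.coeff_sum, Finsupp.finsetSum_apply,
    MonoidAlgebra.coeff_zero, Finsupp.zero_apply] at hcoef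
  rw [Finset.sum_eq_single_of_mem s hsx] at hcoef
  · have h1 : sinv s * s * (domIdem s).val = (1 : MaxSubgroup (domIdem s)).val :=
      (domIdem s).mul_self
    rw [groupPart_single_of_eq h1] at hcoef
    simpa using hcoef
  · intro t ht hts
    by_cases H : ∃ g : MaxSubgroup (domIdem s), sinv s * t * (domIdem s).val = g.val
    · obtain ⟨g, hg⟩ := H
      rw [groupPart_single_of_eq hg, MonoidAlgebra.coeff_single, Finsupp.single_apply, if_neg]
      rintro rfl
      have hst : s ≤ t := mul_sinv_mul_eq_of_sinv_mul_mul hg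
      have htZ : t ∉ Z := fun htZ => hsZ (by
        have : t * (sinv s * s) = s := hst
        rw [← this]
        exact hZr _ htZ _)
      exact hts (le_antisymm (hs.2 (Finset.mem_filter.2 ⟨ht, htZ⟩) hst) hst)
    · push Not at H
      rw [groupPart_single_of_forall_ne H, MonoidAlgebra.coeff_zero, Finsupp.zero_apply]

/-- The quotient of `RS` by the span of an ideal `Z` of `S` is semiprime if the group algebras at
the idempotents outside `Z` are. -/
theorem isSemiprimeRing_of_forall_maxSubgroup {Z : Set S} (hZl : ∀ s, ∀ t ∈ Z, s * t ∈ Z)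
    (hZr : ∀ s ∈ Z, ∀ t, s * t ∈ Z) {B : Type*} [NonUnitalRing B]
    (π : MonoidAlgebra R S →ₙ+* B) (hπ : Function.Surjective π)
    (hker : ∀ x, π x = 0 ↔ ∀ s, s ∉ Z → x.coeff s = 0)
    (h : ∀ e : Idem S, e.val ∉ Z → IsSemiprimeRing (MonoidAlgebra R (MaxSubgroup e))) :
    IsSemiprimeRing B := by
  refine isSemiprimeRing_of_forall_eq_zero fun I hI b hb => ?_
  -- the `G_e`-parts of the preimage of a square-zero ideal form a square-zero ideal of `RG_e`
  have hφ : ∀ e : Idem S, e.val ∉ Z → ∀ x, π x ∈ I → groupPart R e x = 0 := by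
    intro e he
    let J : TwoSidedIdeal (MonoidAlgebra R (MaxSubgroup e)) := TwoSidedIdeal.mk'
      {c | ∃ x, π x ∈ I ∧ groupPart R e x = c}
      ⟨0, by rw [map_zero]; exact I.zero_mem, map_zero _⟩
      (by
        rintro _ _ ⟨x, hx, rfl⟩ ⟨y, hy, rfl⟩
        exact ⟨x + y, by rw [map_add]; exact I.add_mem hx hy, map_add _ _ _⟩)
      (by
        rintro _ ⟨x, hx, rfl⟩
        exact ⟨-x, by rw [map_neg]; exact I.neg_mem hx, map_neg _ _⟩)
      (by
        rintro c _ ⟨x, hx, rfl⟩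
        exact ⟨groupIncl R e c * x, by rw [map_mul]; exact I.mul_mem_left _ _ hx,
          groupPart_groupIncl_mul c x⟩)
      (by
        rintro _ c ⟨x, hx, rfl⟩
        exact ⟨x * groupIncl R e c, by rw [map_mul]; exact I.mul_mem_right _ _ hx,
          groupPart_mul_groupIncl x c⟩)
    have hmem : ∀ c, c ∈ J ↔ ∃ x, π x ∈ I ∧ groupPart R e x = c :=
      fun c => TwoSidedIdeal.mem_mk' _ _ _ _ _ _ c
    have hJ : J = ⊥ := h e he J (by
      intro c hc d hd
      obtain ⟨x, hx, rfl⟩ := (hmem c).1 hc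
      obtain ⟨y, hy, rfl⟩ := (hmem d).1 hd
      obtain ⟨p, hp⟩ := exists_groupPart_mul_mul (e := e) y
      rw [← hp x]
      refine groupPart_eq_zero_of_supported hZl hZr he ((hker _).1 ?_)
      rw [map_mul]
      exact hI _ hx _ (by rw [map_mul]; exact I.mul_mem_left _ _ hy))
    intro x hx
    have := (hmem _).2 ⟨x, hx, rfl⟩
    rwa [hJ, TwoSidedIdeal.mem_bot] at this
  obtain ⟨x, rfl⟩ := hπ b
  rw [hker]
  refine coeff_eq_zero_of_groupPart hZr fun s hs => hφ _ (fun hd => hs ?_) _ ?_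
  · rw [← mul_domIdem s]
    exact hZl _ _ hd
  · rw [map_mul]
    exact I.mul_mem_left _ _ hb

end Direct

/-! ### The converse over a pseudofinite semilattice -/

section Converse

variable {e : Idem S}

/-- Over a pseudofinite semilattice the finitely many factors `e - f`, for `f` running through
generators of the set of idempotents strictly below `e`, suffice: some `e + q`
annihilates all of them. -/
theorem IsPseudofinite.exists_below (hE : IsPseudofinite (Idem S)) (R : Type*) [CommRing R]
    (e : Idem S) :
    ∃ q ∈ below R e, ∀ f : Idem S, f < e → (single e.val 1 + q) * single f.val (1 : R) = 0 := by
  obtain ⟨F, hF⟩ := hE e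
  obtain ⟨q, hq, h⟩ := exists_below_mul_eq_zero (R := R) (e := e) F fun f hf => by
    have : f ∈ Set.Iio e := hF ▸ subset_lowerClosure hf
    exact this
  refine ⟨q, hq, fun f hf => ?_⟩
  have hf' : f ∈ (lowerClosure (F : Set (Idem S)) : Set (Idem S)) := hF ▸ hf
  obtain ⟨g, hg, hfg⟩ := mem_lowerClosure.1 hf'
  rw [← Idem.mul_eq_of_le' hfg, ← mul_one (1 : R), ← MonoidAlgebra.single_mul_single,
    ← mul_assoc, mul_one, h g hg, zero_mul]

variable {q : MonoidAlgebra R S}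

/-- The element `e + q` commutes with idempotents, so it annihilates those below `e` on both
sides. -/
theorem single_mul_eq_zero_of_lt (hq : q ∈ below R e)
    (h : ∀ f : Idem S, f < e → (single e.val 1 + q) * single f.val (1 : R) = 0)
    {f : Idem S} (hf : f < e) : single f.val (1 : R) * (single e.val 1 + q) = 0 := by
  rw [← h f hf, mul_add, add_mul, MonoidAlgebra.single_mul_single,
    MonoidAlgebra.single_mul_single, idem_comm f.mul_self e.mul_self]
  congr 1
  rw [← sub_eq_zero]
  refine eq_zero_of_mem_below (l := LinearMap.mulLeft R (single f.val (1 : R)) -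
    LinearMap.mulRight R (single f.val (1 : R))) (fun g _ => ?_) hq
  simp [MonoidAlgebra.single_mul_single, idem_comm f.mul_self g.mul_self]

/-- Conjugation by `g ∈ G_e` permutes the idempotents strictly below `e`, so the terms of
`q * g * (e + q)` vanish. -/
theorem mul_single_maxSubgroup_mul (hq : q ∈ below R e)
    (h : ∀ f : Idem S, f < e → (single e.val 1 + q) * single f.val (1 : R) = 0)
    (g : MaxSubgroup e) (r : R) :
    (single e.val 1 + q) * (single g.val r * (single e.val 1 + q)) =
      single g.val r * (single e.val 1 + q) := by
  conv_lhs => rw [add_mul, ← mul_assoc, MonoidAlgebra.single_mul_single, one_mul, g.idem_mul_val]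
  rw [add_eq_left, ← mul_assoc]
  refine eq_zero_of_mem_below (l := LinearMap.mulRight R (single e.val 1 + q) ∘ₗ
    LinearMap.mulRight R (single g.val r)) (fun f hf => ?_) hq
  -- `f g = g (g* f g)` with `g* f g < e`
  have hconj : f.val * g.val = g.val * (ranIdem (g⁻¹.val * f.val)).val := by
    have h1 : g.val * (g⁻¹.val * f.val) = f.val := by
      rw [MaxSubgroup.val_inv, ← mul_assoc, g.mul_sinv, Idem.mul_eq_of_le' hf.le]
    rw [ranIdem, ← mul_assoc, h1, sinv_mul_rev, sinv_of_idem f.mul_self, MaxSubgroup.val_inv,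
      sinv_sinv, ← mul_assoc, f.mul_self]
  rw [LinearMap.comp_apply, LinearMap.mulRight_apply, LinearMap.mulRight_apply,
    MonoidAlgebra.single_mul_single, hconj, one_mul, ← mul_one r,
    ← MonoidAlgebra.single_mul_single, mul_assoc,
    single_mul_eq_zero_of_lt hq h (g⁻¹.conj_lt hf), mul_zero]

/-- The corner of `RS` at `p = e + q` is `RG_e p`: an element of `e S e` outside `G_e` has its
domain or its range idempotent strictly below `e` and is annihilated by `p` on that side. -/
theorem exists_mul_mul_eq_groupIncl_mul (hq : q ∈ below R e)
    (h : ∀ f : Idem S, f < e → (single e.val 1 + q) * single f.val (1 : R) = 0)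
    (x : MonoidAlgebra R S) :
    ∃ b : MonoidAlgebra R (MaxSubgroup e),
      (single e.val 1 + q) * (x * (single e.val 1 + q)) =
        groupIncl R e b * (single e.val 1 + q) := by
  have hpe : (single e.val 1 + q) * single e.val (1 : R) = single e.val 1 + q := by
    rw [add_mul, MonoidAlgebra.single_mul_single, e.mul_self, mul_one]
    congr 1
    rw [← sub_eq_zero]
    refine eq_zero_of_mem_below (l := LinearMap.mulRight R (single e.val (1 : R)) -
      LinearMap.id) (fun f hf => ?_) hq
    simp [MonoidAlgebra.single_mul_single, Idem.mul_eq_of_le hf.le]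
  have hep : single e.val (1 : R) * (single e.val 1 + q) = single e.val 1 + q := by
    rw [mul_add, MonoidAlgebra.single_mul_single, e.mul_self, mul_one]
    congr 1
    rw [← sub_eq_zero]
    refine eq_zero_of_mem_below (l := LinearMap.mulLeft R (single e.val (1 : R)) -
      LinearMap.id) (fun f hf => ?_) hq
    simp [MonoidAlgebra.single_mul_single, Idem.mul_eq_of_le' hf.le]
  induction x using MonoidAlgebra.induction_linear with
  | zero => exact ⟨0, by simp⟩
  | add x y hx hy =>
    obtain ⟨b, hb⟩ := hx
    obtain ⟨c, hc⟩ := hy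
    exact ⟨b + c, by rw [add_mul x y, mul_add (_ + q), hb, hc, map_add, add_mul (groupIncl R e b)]⟩
  | single s r =>
    set w := e.val * s * e.val with hw
    have hwe : w * e.val = w := by rw [hw, mul_assoc, e.mul_self]
    have hew : e.val * w = w := by rw [hw, ← mul_assoc, ← mul_assoc, e.mul_self]
    have hpw : (single e.val 1 + q) * (single s r * (single e.val 1 + q)) =
        (single e.val 1 + q) * (single w r * (single e.val 1 + q)) := by
      have hws : (single w r : MonoidAlgebra R S) =
          single e.val 1 * single s r * single e.val 1 := by
        rw [MonoidAlgebra.single_mul_single, MonoidAlgebra.single_mul_single, one_mul, mul_one]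
      rw [hws, mul_assoc (_ * _), hep, mul_assoc (single e.val 1), ← mul_assoc (_ + _) (single e.val 1),
        hpe]
    rw [hpw]
    rcases (ranIdem_le hew).lt_or_eq with hr | hr
    · refine ⟨0, ?_⟩
      rw [← ranIdem_mul w, ← one_mul r, ← MonoidAlgebra.single_mul_single, mul_assoc,
        ← mul_assoc, h _ hr]
      simp
    rcases (domIdem_le hwe).lt_or_eq with hd | hd
    · refine ⟨0, ?_⟩
      rw [← mul_domIdem w, ← mul_one r, ← MonoidAlgebra.single_mul_single, mul_assoc,
        single_mul_eq_zero_of_lt hq h hd]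
      simp
    let g : MaxSubgroup e := ⟨w, congrArg Idem.val hd, congrArg Idem.val hr⟩
    exact ⟨single g r, by rw [mul_single_maxSubgroup_mul hq h g r, groupIncl_single]⟩

/-- If the quotient of `RS` by the span of an ideal `Z` of `S` is semiprime and `E(S)` is
pseudofinite, then the group algebras at the idempotents outside `Z` are semiprime. -/
theorem isSemiprimeRing_maxSubgroup {Z : Set S} (hZl : ∀ s, ∀ t ∈ Z, s * t ∈ Z)
    (hZr : ∀ s ∈ Z, ∀ t, s * t ∈ Z) {B : Type*} [NonUnitalRing B]
    (π : MonoidAlgebra R S →ₙ+* B) (hπ : Function.Surjective π)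
    (hker : ∀ x, π x = 0 ↔ ∀ s, s ∉ Z → x.coeff s = 0)
    (hE : IsPseudofinite (Idem S)) (hB : IsSemiprimeRing B) (he : e.val ∉ Z) :
    IsSemiprimeRing (MonoidAlgebra R (MaxSubgroup e)) := by
  obtain ⟨q, hq, h⟩ := hE.exists_below R e
  refine isSemiprimeRing_of_forall_eq_zero fun J hJ j hj => ?_
  set p := single e.val 1 + q with hp
  have hcomm : ∀ b, p * (groupIncl R e b * p) = groupIncl R e b * p := by
    intro b
    induction b using MonoidAlgebra.induction_linear with
    | zero => simp
    | add b c hb hc => rw [map_add, add_mul (groupIncl R e b), mul_add p, hb, hc]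
    | single g r => rw [groupIncl_single, hp, mul_single_maxSubgroup_mul hq h]
  -- `j p` generates a square-zero ideal modulo `Z`, because `p RS p = RG_e p` and `J² = 0`
  have hπj : π (groupIncl R e j * p) = 0 := by
    refine hB.eq_zero ?_ fun y => ?_
    · rw [← map_mul, mul_assoc, hcomm, ← mul_assoc, ← map_mul, hJ j hj j hj, map_zero, zero_mul,
        map_zero]
    · obtain ⟨x, rfl⟩ := hπ y
      obtain ⟨b, hb⟩ := exists_mul_mul_eq_groupIncl_mul hq h x
      have hb' : p * (x * p) = groupIncl R e b * p := hb
      rw [← map_mul, ← map_mul]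
      have : groupIncl R e j * p * x * (groupIncl R e j * p) = 0 := by
        calc groupIncl R e j * p * x * (groupIncl R e j * p)
            = groupIncl R e j * p * x * (p * (groupIncl R e j * p)) := by rw [hcomm]
          _ = groupIncl R e j * (p * (x * p)) * (groupIncl R e j * p) := by
            simp only [mul_assoc]
          _ = groupIncl R e j * groupIncl R e b * (p * (groupIncl R e j * p)) := by
            rw [hb']; simp only [mul_assoc]
          _ = groupIncl R e (j * b * j) * p := by
            rw [hcomm, map_mul, map_mul]; simp only [mul_assoc]
          _ = 0 := by rw [hJ _ (J.mul_mem_right _ _ hj) _ hj, map_zero, zero_mul]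
      rw [this, map_zero]
  have := groupPart_eq_zero_of_supported hZl hZr he ((hker _).1 hπj)
  rwa [hp, mul_add, map_add, groupPart_mul_single_idem, groupPart_mul_below _ hq, add_zero,
    groupPart_groupIncl] at this

end Converse

end SemigroupAlgebra

/-! ### The contracted semigroup algebra -/

section ContractedAlgebra

variable (R : Type*) [CommRing R] {S : Type*} [Semigroup S]

/-- The quotient map `RS → R₀S`. -/
noncomputable def contractedMk {z : S} (hz : IsZeroElem z) :
    MonoidAlgebra R S →ₙ+* ContractedAlgebra R hz where
  toFun x := (x : ContractedAlgebra R hz)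
  map_mul' _ _ := rfl
  map_zero' := rfl
  map_add' _ _ := rfl

theorem contractedMk_surjective {z : S} (hz : IsZeroElem z) :
    Function.Surjective (contractedMk R hz) := fun b => by
  induction b using Quotient.inductionOn' with
  | h x => exact ⟨x, rfl⟩

theorem contractedMk_eq_zero_iff {z : S} (hz : IsZeroElem z) (x : MonoidAlgebra R S) :
    contractedMk R hz x = 0 ↔ ∀ s, s ∉ ({z} : Set S) → x.coeff s = 0 := by
  classical
  have h1 : contractedMk R hz x = 0 ↔ x ∈ zeroIdeal R hz :=
    (RingCon.eq _ (a := x) (b := 0))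
  rw [h1, zeroIdeal, TwoSidedIdeal.mem_mk']
  constructor
  · rintro ⟨r, rfl⟩ s hs
    rw [MonoidAlgebra.coeff_single, Finsupp.single_apply, if_neg fun h => hs h.symm]
  · intro h
    refine ⟨x.coeff z, ?_⟩
    ext s
    rw [MonoidAlgebra.coeff_single, Finsupp.single_apply]
    split_ifs with hs
    · rw [hs]
    · exact h s fun h => hs h.symm

/-- A square-zero scalar `r` kills `R₀S` when the latter is semiprime, so it vanishes as soon as
`S ≠ {z}`. -/
theorem scalar_eq_zero_of_mul_self_eq_zero {z s : S} (hz : IsZeroElem z) (hs : s ≠ z)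
    (hB : IsSemiprimeRing (ContractedAlgebra R hz)) {r : R} (hr : r * r = 0) : r = 0 := by
  have h0 : contractedMk R hz (single s r) = 0 := by
    refine hB.eq_zero ?_ fun y => ?_
    · rw [← map_mul, MonoidAlgebra.single_mul_single, hr, MonoidAlgebra.single_zero, map_zero]
    · obtain ⟨x, rfl⟩ := contractedMk_surjective R hz y
      rw [← map_mul, ← map_mul]
      have : single s r * x * single s r = 0 := by
        induction x using MonoidAlgebra.induction_linear with
        | zero => simp
        | add x y hx hy => rw [mul_add, add_mul, hx, hy, add_zero]
        | single t a =>
          rw [MonoidAlgebra.single_mul_single, MonoidAlgebra.single_mul_single, mul_right_comm,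
            hr, zero_mul, MonoidAlgebra.single_zero]
      rw [this, map_zero]
  simpa using (contractedMk_eq_zero_iff R hz _).1 h0 s hs

/-- The maximal subgroup at a zero element is trivial. -/
theorem subsingleton_maxSubgroup_zero [IsInverseSemigroup S] {z : S} (hz : IsZeroElem z)
    {e : Idem S} (he : e.val = z) : Subsingleton (MaxSubgroup e) :=
  ⟨fun g h => MaxSubgroup.ext' (by
    rw [← g.val_mul_idem, ← h.val_mul_idem, he, (hz _).2, (hz _).2])⟩

end ContractedAlgebra

/-- The algebra of a trivial group over a reduced ring is semiprime. -/
theorem isSemiprimeRing_of_subsingleton {R G : Type*} [CommRing R] [Group G] [Subsingleton G]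
    (hR : ∀ r : R, r * r = 0 → r = 0) : IsSemiprimeRing (MonoidAlgebra R G) := by
  refine isSemiprimeRing_of_forall_eq_zero fun J hJ j hj => ?_
  have hj1 : j = single 1 (j.coeff 1) := by
    ext g
    simp [Subsingleton.elim g 1]
  have h := hJ j hj j hj
  rw [hj1, MonoidAlgebra.single_mul_single, MonoidAlgebra.single_eq_zero] at h
  rw [hj1, hR _ h, MonoidAlgebra.single_zero]

end InvSemigroup

theorem mainTheorem10 (R : Type*) [CommRing R] (S : Type*) [Semigroup S] [IsInverseSemigroup S] :
    -- the semigroup algebra `RS`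
    ((∀ e : InvSemigroup.Idem S,
        InvSemigroup.IsSemiprimeRing (MonoidAlgebra R (InvSemigroup.MaxSubgroup e))) →
      InvSemigroup.IsSemiprimeRing (MonoidAlgebra R S)) ∧
    (InvSemigroup.IsPseudofinite (InvSemigroup.Idem S) →
      InvSemigroup.IsSemiprimeRing (MonoidAlgebra R S) →
      ∀ e : InvSemigroup.Idem S,
        InvSemigroup.IsSemiprimeRing (MonoidAlgebra R (InvSemigroup.MaxSubgroup e))) ∧
    -- the contracted semigroup algebra `R₀S`, when `S` has a zero element `z`
    (∀ (z : S) (hz : InvSemigroup.IsZeroElem z),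
      ((∀ e : InvSemigroup.Idem S, e.val ≠ z →
          InvSemigroup.IsSemiprimeRing (MonoidAlgebra R (InvSemigroup.MaxSubgroup e))) →
        InvSemigroup.IsSemiprimeRing (InvSemigroup.ContractedAlgebra R hz)) ∧
      (InvSemigroup.IsPseudofinite (InvSemigroup.Idem S) →
        InvSemigroup.IsSemiprimeRing (InvSemigroup.ContractedAlgebra R hz) →
        (∃ s : S, s ≠ z) →
        ∀ e : InvSemigroup.Idem S,
          InvSemigroup.IsSemiprimeRing (MonoidAlgebra R (InvSemigroup.MaxSubgroup e)))) := by
  refine ⟨fun h => ?_, fun hE hB e => ?_, fun z hz => ⟨fun h => ?_, fun hE hB hS e => ?_⟩⟩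
  · exact InvSemigroup.isSemiprimeRing_of_forall_maxSubgroup (Z := ∅) (by simp) (by simp)
      (NonUnitalRingHom.id _) Function.surjective_id
      (fun x => by simp [← MonoidAlgebra.coeff_inj, Finsupp.ext_iff]) (fun e _ => h e)
  · exact InvSemigroup.isSemiprimeRing_maxSubgroup (Z := ∅) (by simp) (by simp)
      (NonUnitalRingHom.id _) Function.surjective_id
      (fun x => by simp [← MonoidAlgebra.coeff_inj, Finsupp.ext_iff]) hE hB (by simp)
  · exact InvSemigroup.isSemiprimeRing_of_forall_maxSubgroup (Z := {z})
      (by rintro s _ rfl; exact (hz s).2) (by rintro _ rfl t; exact (hz t).1)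
      (InvSemigroup.contractedMk R hz) (InvSemigroup.contractedMk_surjective R hz)
      (InvSemigroup.contractedMk_eq_zero_iff R hz) h
  · by_cases he : e.val = z
    · have := InvSemigroup.subsingleton_maxSubgroup_zero hz he
      obtain ⟨s, hs⟩ := hS
      exact InvSemigroup.isSemiprimeRing_of_subsingleton fun r hr =>
        InvSemigroup.scalar_eq_zero_of_mul_self_eq_zero R hz hs hB hr
    · exact InvSemigroup.isSemiprimeRing_maxSubgroup (Z := {z})
        (by rintro s _ rfl; exact (hz s).2) (by rintro _ rfl t; exact (hz t).1)
        (InvSemigroup.contractedMk R hz) (InvSemigroup.contractedMk_surjective R hz)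
        (InvSemigroup.contractedMk_eq_zero_iff R hz) hE hB he
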